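/- The game of *Containment* is played on a finite simple graph $G$ by a set of cops, who occupy edges (several cops may share an edge), and one robber, who occupies a vertex. First the cops are placed on edges, then the robber chooses a vertex, and then the two sides move alternately, the cops first, with full information. In a cop move, each cop stays on its edge or moves to an edge sharing an endpoint with it; in her move, the robber stays at her vertex or moves to a neighbouring vertex along an edge not currently occupied by a cop. The cops win if at some moment all edges incident with the robber's vertex are occupied by cops. The containability number $\xi(G)$ is the minimum number of cops that have a winning strategy. Let $\mathcal G(n,p)$ be the random graph on $n$ labelled vertices in which each pair of vertices is joined by an edge independently with probability $p$. **Lemma.** Let $p=p(n)\in[0,1]$ and $d=d(n)=p(n-1)$, and let $r=r(n)$ be positive integers, such that for all sufficiently large $n$ $$d\ge \log^3 n \qquad\text{and}\qquad (n\log n)^{\frac1{2r+1}}\le d\le (n\log n)^{\frac1{2r}}.$$ Then asymptotically almost surely $\xi(\mathcal G(n,p))=O(d^{r+1})$; that is, there is a constant $K>0$ such that $$\lim_{n\to\infty}\mathbb P\bigl(\xi(\mathcal G(n,p))\le K\,d^{\,r+1}\bigr)=1.$$ -/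

import Mathlib

namespace Containment

variable {V : Type*}

/-- The robber's first `t` positions `x 0, …, x (t - 1)`, most recent first. -/
def history (x : ℕ → V) : ℕ → List V
  | 0 => []
  | t + 1 => x t :: history x t

/-- A (deterministic, history-dependent) strategy for `k` cops in the game of Containment on `G`.
Cops occupy edges, and several cops may share an edge. `pos [] i` is the edge on which cop `i` is
placed before the robber appears, and `pos h i` is the edge occupied by cop `i` right after the
cops have answered the robber's positions listed in `h` (most recent first). In every cop move
each cop stays where it is or moves to an edge sharing an endpoint with its current edge. -/
structure CopStrategy (G : SimpleGraph V) (k : ℕ) where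
  pos : List V → Fin k → G.edgeSet
  legal : ∀ (h : List V) (v : V) (i : Fin k),
    pos (v :: h) i = pos h i ∨ G.lineGraph.Adj (pos h i) (pos (v :: h) i)

/-- `x` is a legal course of play for the robber against the strategy `σ`. The cops are placed
first, then the robber chooses the vertex `x 0`, and from then on the cops and the robber move
alternately, the cops first. In her move the robber stays where she is or goes to a neighbouring
vertex along an edge that is not currently occupied by a cop. -/
def IsRobberPlay {G : SimpleGraph V} {k : ℕ} (σ : CopStrategy G k) (x : ℕ → V) : Prop :=
  ∀ t, x (t + 1) = x t ∨
    (G.Adj (x t) (x (t + 1)) ∧ ∀ i, (σ.pos (history x (t + 1)) i : Sym2 V) ≠ s(x t, x (t + 1)))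

/-- A strategy for the cops is winning if against every legal play of the robber there is a moment
at which all the edges incident with the robber's vertex are occupied by cops. -/
def CopStrategy.IsWinning {G : SimpleGraph V} {k : ℕ} (σ : CopStrategy G k) : Prop :=
  ∀ x : ℕ → V, IsRobberPlay σ x →
    ∃ t, ∀ e ∈ G.incidenceSet (x t), ∃ i, (σ.pos (history x (t + 1)) i : Sym2 V) = e

/-- The containability number `ξ(G)` of a finite graph: the least number of cops that have a winning
strategy. -/
noncomputable def containabilityNumber (G : SimpleGraph V) : ℕ :=
  sInf {k | ∃ σ : CopStrategy G k, σ.IsWinning}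

/-- On a finite graph some number of cops wins (one cop on each edge), so that the infimum defining
the containability number is attained. -/
theorem exists_isWinning [Finite V] (G : SimpleGraph V) :
    ∃ k, ∃ σ : CopStrategy G k, σ.IsWinning := by
  obtain ⟨k, ⟨f⟩⟩ := Finite.exists_equiv_fin G.edgeSet
  refine ⟨k, ⟨fun _ i => f.symm i, fun _ _ _ => Or.inl rfl⟩, fun x _ => ⟨0, fun e he => ?_⟩⟩
  exact ⟨f ⟨e, he.1⟩, by simp⟩

end Containment

/-!
# Containment on the binomial random graph: the bound `O(d ^ (r + 1))`

The cops move as fast as the robber, so they need not react to her after her first choice of a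
vertex `v`. Each of the edges that meet the ball of radius `r` around `v` is assigned its own cop,
who goes there along a shortest route. If all these routes take at most `r + 1` moves, then after
them the robber has moved only `r` times and is still in the ball, and every edge at her vertex is
occupied. By Hall's theorem (`containabilityNumber_le_of_hall`) such an assignment exists as soon
as every set `A` of edges meeting the ball has at least `#A` cops at distance at most `r` from the
vertices that it covers.

With `n` the number of vertices and `L = log n`, this condition holds for about `K d ^ (r + 1)` cops
placed near independent uniform vertices. In a typical graph (`IsTypical`) a set of `k` vertices
with `k d ^ r ≤ n / 4` has at least `k d ^ r / 8` vertices within distance `r`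
(`IsTypical.le_card_ball`), hence a number of cops of order `K k d ^ (2r + 1) / n ≥ K k L`. The lower
bound on `d` makes this large enough to survive the union bound over all `n ^ k` sets of size `k`
(`exists_placement`). On the other side, `k` vertices span at most `k (3 L + 2 p k)` edges, which is
again of order at most `k d ^ (2r + 1) / n`. For larger sets a positive fraction of all the cops is
nearby, and only `4 d ^ (r + 1)` edges meet the ball at all (`IsTypical.card_ball_le`,
`IsTypical.card_edges_le`).

The relative error `ε = 4 / L` in degrees and expansion is small enough to be lost in each of the
`r ≤ L / 16` layers of a ball, and since `d ≥ L ^ 3` gives `ε ^ 2 d ≥ 16 L`, Chernoff bounds with this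
error survive the union bounds (`measureReal_not_isTypical_le`). These bounds all come from one
identity, the generating function of the number of random edges in a fixed set of pairs
(`integral_pow_card_edges`).
-/

namespace Containment

open Finset MeasureTheory

/-! ### Balls around sets of vertices -/

section Balls

variable {V : Type*} [Fintype V]

open Classical in
/-- The vertices outside `U` that have a neighbour in `U`. -/
noncomputable def outerBoundary (G : SimpleGraph V) (U : Finset V) : Finset V :=
  {x | x ∉ U ∧ ∃ u ∈ U, G.Adj u x}

open Classical in
/-- The set of vertices at distance at most `r` from `U`, built up one layer at a time. -/
noncomputable def ball (G : SimpleGraph V) (U : Finset V) : ℕ → Finset V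
  | 0 => U
  | j + 1 => ball G U j ∪ outerBoundary G (ball G U j)

open Classical in
/-- The vertices covered by a set of edges. -/
noncomputable def covered (A : Finset (Sym2 V)) : Finset V :=
  {u | ∃ e ∈ A, u ∈ e}

theorem mem_outerBoundary {G : SimpleGraph V} {U : Finset V} {x : V} :
    x ∈ outerBoundary G U ↔ x ∉ U ∧ ∃ u ∈ U, G.Adj u x := by
  simp [outerBoundary]

theorem mem_covered {A : Finset (Sym2 V)} {u : V} : u ∈ covered A ↔ ∃ e ∈ A, u ∈ e := by
  simp [covered]

theorem mem_ball_succ {G : SimpleGraph V} {U : Finset V} {j : ℕ} {x : V} :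
    x ∈ ball G U (j + 1) ↔ x ∈ ball G U j ∨ ∃ u ∈ ball G U j, G.Adj u x := by
  classical
  simp only [ball, mem_union, mem_outerBoundary]
  tauto

theorem card_ball_succ (G : SimpleGraph V) (U : Finset V) (j : ℕ) :
    #(ball G U (j + 1)) = #(ball G U j) + #(outerBoundary G (ball G U j)) := by
  classical
  rw [ball, card_union_of_disjoint]
  exact Finset.disjoint_right.2 fun x hx => (mem_outerBoundary.1 hx).1

theorem mem_ball_iff_exists_walk {G : SimpleGraph V} {U : Finset V} {r : ℕ} {x : V} :
    x ∈ ball G U r ↔ ∃ u ∈ U, ∃ w : G.Walk u x, w.length ≤ r := by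
  induction r generalizing x with
  | zero =>
    constructor
    · intro hx
      exact ⟨x, hx, .nil, le_rfl⟩
    · rintro ⟨u, hu, w, hw⟩
      rw [← w.eq_of_length_eq_zero (by omega)]
      exact hu
  | succ r ih =>
    rw [mem_ball_succ]
    constructor
    · rintro (hx | ⟨y, hy, hyx⟩)
      · obtain ⟨u, hu, w, hw⟩ := ih.1 hx
        exact ⟨u, hu, w, by omega⟩
      · obtain ⟨u, hu, w, hw⟩ := ih.1 hy
        exact ⟨u, hu, w.concat hyx, by simpa using hw⟩
    · rintro ⟨u, hu, w, hw⟩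
      rcases hw.lt_or_eq with hlt | heq
      · exact Or.inl (ih.2 ⟨u, hu, w, by omega⟩)
      · obtain ⟨y, w', hyx, rfl⟩ : ∃ y, ∃ w' : G.Walk u y, ∃ h : G.Adj y x, w = w'.concat h := by
          cases w with
          | nil => simp at heq
          | cons h q =>
            obtain ⟨y, q', h', hq⟩ := SimpleGraph.Walk.exists_cons_eq_concat h q
            exact ⟨y, q', h', hq⟩
        refine Or.inr ⟨y, ih.2 ⟨u, hu, w', ?_⟩, hyx⟩
        simpa using hw

theorem ball_mono {G : SimpleGraph V} {U U' : Finset V} (h : U ⊆ U') (r : ℕ) :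
    ball G U r ⊆ ball G U' r := by
  intro x hx
  obtain ⟨u, hu, w⟩ := mem_ball_iff_exists_walk.1 hx
  exact mem_ball_iff_exists_walk.2 ⟨u, h hu, w⟩

end Balls

/-! ### A Hall-type criterion for the cops -/

section Game

variable {V : Type*}

/-- Successive edges of a walk meet, so a walk of `ℓ` steps from `x` to `u` carries a cop from any
edge at `x` to any edge at `u` in `ℓ + 1` moves. -/
theorem exists_lineGraph_walk {G : SimpleGraph V} {x u : V} (w : G.Walk x u)
    (e₀ e : G.edgeSet) (hx : x ∈ (e₀ : Sym2 V)) (hu : u ∈ (e : Sym2 V)) :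
    ∃ q : G.lineGraph.Walk e₀ e, q.length ≤ w.length + 1 := by
  induction w generalizing e₀ with
  | nil =>
    by_cases h : e₀ = e
    · subst h
      exact ⟨.nil, by simp⟩
    · have hadj : G.lineGraph.Adj e₀ e := ⟨h, _, hx, hu⟩
      exact ⟨.cons hadj .nil, by simp⟩
  | @cons x y u hxy w ih =>
    let e₁ : G.edgeSet := ⟨s(x, y), hxy⟩
    obtain ⟨q, hq⟩ := ih e₁ (Sym2.mem_mk_right x y) hu
    by_cases h : e₀ = e₁
    · subst h
      exact ⟨q, by simp; omega⟩
    · have hadj : G.lineGraph.Adj e₀ e₁ := ⟨h, _, hx, Sym2.mem_mk_left x y⟩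
      exact ⟨.cons hadj q, by simpa using hq⟩

/-- The strategy in which cop `i` starts at `s i` and, once the robber has chosen the vertex `v`,
follows the sequence of edges `m v i`, whatever the robber does. -/
def CopStrategy.ofRoutes {G : SimpleGraph V} {k : ℕ} (s : Fin k → G.edgeSet)
    (m : V → Fin k → ℕ → G.edgeSet) (hs : ∀ v i, m v i 0 = s i)
    (hm : ∀ v i t, m v i (t + 1) = m v i t ∨ G.lineGraph.Adj (m v i t) (m v i (t + 1))) :
    CopStrategy G k where
  pos h i := match h.getLast? with
    | none => s i
    | some v => m v i h.length
  legal h v i := by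
    rcases h with _ | ⟨a, l⟩
    · simpa [hs] using hm v i 0
    · have h1 : (v :: a :: l).getLast? = (a :: l).getLast? := by simp
      obtain ⟨b, hb⟩ : ∃ b, (a :: l).getLast? = some b := by
        simp [List.getLast?_cons]
      simp only [h1, hb]
      exact hm b i (a :: l).length

theorem length_history (x : ℕ → V) (t : ℕ) : (history x t).length = t := by
  induction t with
  | zero => rfl
  | succ t ih => simp [history, ih]

theorem getLast?_history_succ (x : ℕ → V) (t : ℕ) :
    (history x (t + 1)).getLast? = some (x 0) := by
  induction t with
  | zero => rfl
  | succ t ih =>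
    rw [history, List.getLast?_cons, ih]
    rfl

theorem mem_ball_of_isRobberPlay [Fintype V] {G : SimpleGraph V} {k : ℕ} {σ : CopStrategy G k}
    {x : ℕ → V} (hx : IsRobberPlay σ x) (t : ℕ) : x t ∈ ball G {x 0} t := by
  induction t with
  | zero => simp [ball]
  | succ t ih =>
    rw [mem_ball_succ]
    rcases hx t with h | h
    · exact Or.inl (h ▸ ih)
    · exact Or.inr ⟨x t, ih, h.1⟩

open Classical in
/-- Cops stand near the vertices `f i`. If, for each possible start `v` of the robber, every set of
edges meeting the ball of radius `r` around `v` has at least as many cops within distance `r` as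
it has edges, then distinct cops can be sent to all the edges meeting that ball. They arrive after
`r + 1` moves, when the robber has not yet left the ball. -/
theorem containabilityNumber_le_of_hall [Fintype V] {G : SimpleGraph V} {N r : ℕ} (f : Fin N → V)
    (hdeg : ∀ x, ∃ y, G.Adj x y)
    (hall : ∀ v, ∀ A : Finset (Sym2 V),
      (∀ e ∈ A, e ∈ G.edgeSet ∧ ∃ u ∈ ball G {v} r, u ∈ e) →
      #A ≤ #{i | f i ∈ ball G (covered A) r}) :
    containabilityNumber G ≤ N := by
  choose y hy using hdeg
  let s : Fin N → G.edgeSet := fun i => ⟨s(f i, y (f i)), hy (f i)⟩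
  -- Hall's theorem gives the assignment of cops to edges.
  have hmatch : ∀ v, ∃ g : {e : Sym2 V // e ∈ G.edgeSet ∧ ∃ u ∈ ball G {v} r, u ∈ e} → Fin N,
      Function.Injective g ∧ ∀ e, g e ∈ ({i | ∃ u ∈ e.1, f i ∈ ball G {u} r} : Finset (Fin N)) := by
    intro v
    rw [← Finset.all_card_le_biUnion_card_iff_exists_injective]
    intro A
    have h := hall v (A.map (Function.Embedding.subtype _)) (by
      intro e he
      obtain ⟨e', -, rfl⟩ := Finset.mem_map.1 he
      exact e'.2)
    rw [card_map] at h
    refine h.trans (card_le_card ?_)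
    intro i hi
    obtain ⟨u, hu, w, hw⟩ := mem_ball_iff_exists_walk.1 (by simpa using hi)
    obtain ⟨e, he, hue⟩ := mem_covered.1 hu
    obtain ⟨e', he', rfl⟩ := Finset.mem_map.1 he
    rw [mem_biUnion]
    refine ⟨e', he', ?_⟩
    simp only [mem_filter, mem_univ, true_and]
    exact ⟨u, by simpa using hue, mem_ball_iff_exists_walk.2 ⟨u, mem_singleton_self u, w, hw⟩⟩
  choose g hginj hg using hmatch
  -- Every cop has a route that reaches the edge assigned to it, if any, within `r + 1` moves.
  have hroute : ∀ v i, ∃ m : ℕ → G.edgeSet, m 0 = s i ∧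
      (∀ t, m (t + 1) = m t ∨ G.lineGraph.Adj (m t) (m (t + 1))) ∧
      ∀ e, g v e = i → (m (r + 1) : Sym2 V) = e := by
    intro v i
    by_cases hi : ∃ e, g v e = i
    · obtain ⟨e, rfl⟩ := hi
      have hge := hg v e
      simp only [mem_filter, mem_univ, true_and] at hge
      obtain ⟨u, hu, hb⟩ := hge
      obtain ⟨u', hu', w, hw⟩ := mem_ball_iff_exists_walk.1 hb
      obtain rfl := mem_singleton.1 hu'
      obtain ⟨q, hq⟩ := exists_lineGraph_walk w.reverse (s (g v e)) ⟨e.1, e.2.1⟩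
        (Sym2.mem_mk_left _ _) hu
      rw [SimpleGraph.Walk.length_reverse] at hq
      refine ⟨q.getVert, q.getVert_zero, fun t => ?_, fun e' he' => ?_⟩
      · rcases lt_or_ge t q.length with ht | ht
        · exact Or.inr (q.adj_getVert_succ ht)
        · left
          rw [q.getVert_of_length_le ht, q.getVert_of_length_le (by omega)]
      · obtain rfl := hginj v he'
        rw [q.getVert_of_length_le (by omega)]
    · exact ⟨fun _ => s i, rfl, fun _ => Or.inl rfl, fun e he => absurd ⟨e, he⟩ hi⟩
  choose m hm0 hmstep hmend using hroute
  refine Nat.sInf_le ⟨CopStrategy.ofRoutes s m hm0 hmstep, fun x hx => ⟨r, fun e he => ?_⟩⟩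
  have hball := mem_ball_of_isRobberPlay hx r
  refine ⟨g (x 0) ⟨e, he.1, x r, hball, he.2⟩, ?_⟩
  simp only [CopStrategy.ofRoutes, getLast?_history_succ, length_history]
  exact hmend _ _ _ rfl

end Game

/-! ### Generating functions in the binomial random graph -/

section RandomGraph

variable {V : Type*} [Fintype V]

instance : MeasurableSingletonClass (SimpleGraph V) where
  measurableSet_singleton G := by
    have h : ({G} : Set (SimpleGraph V)) = SimpleGraph.edgeSet ⁻¹' {G.edgeSet} := by
      ext H
      simp
    rw [h]
    exact SimpleGraph.measurable_edgeSet (Set.toFinite _).measurableSet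

open Classical in
/-- The number of edges of the random graph in a fixed set `A` of `m` pairs has the probability
generating function `(1 - p + p θ) ^ m` of a binomial variable. -/
theorem integral_pow_card_edges (p : unitInterval) (A : Finset (Sym2 V))
    (hA : ∀ e ∈ A, ¬ e.IsDiag) (θ : ℝ) :
    ∫ G, θ ^ #{e ∈ A | e ∈ G.edgeSet} ∂(SimpleGraph.binomialRandom V p) =
      (1 - p + p * θ) ^ #A := by
  let D : Finset (Sym2 V) := {e | ¬ e.IsDiag}
  have hAD : A ⊆ D := fun e he => by simpa [D] using hA e he
  have hDcard : (Nat.card V).choose 2 = #D := by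
    rw [Nat.card_eq_fintype_card, ← Sym2.card_diagSet_compl, Fintype.card_subtype]
    congr 1
  have hsub : ∀ G : SimpleGraph V, G.edgeFinset ⊆ D := fun G e he => by
    simpa [D] using G.not_isDiag_of_mem_edgeSet (SimpleGraph.mem_edgeFinset.1 he)
  have hsingle : ∀ G : SimpleGraph V, (SimpleGraph.binomialRandom V p).real {G} =
      (p : ℝ) ^ #G.edgeFinset * (1 - p : ℝ) ^ #(D \ G.edgeFinset) := by
    intro G
    have h1 : G.edgeSet.ncard = #G.edgeFinset := by
      rw [← SimpleGraph.coe_edgeFinset, Set.ncard_coe_finset]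
    rw [measureReal_def, SimpleGraph.binomialRandom_singleton, h1, hDcard,
      card_sdiff_of_subset (hsub G)]
    simp
  rw [integral_fintype (.of_finite)]
  calc ∑ G : SimpleGraph V, (SimpleGraph.binomialRandom V p).real {G} •
        θ ^ #{e ∈ A | e ∈ G.edgeSet}
      = ∑ s ∈ D.powerset, (∏ e ∈ s, ((p : ℝ) * if e ∈ A then θ else 1)) *
          ∏ _e ∈ D \ s, (1 - p : ℝ) := by
        refine Finset.sum_nbij' (fun G => G.edgeFinset)
          (fun s => SimpleGraph.fromEdgeSet (s : Set (Sym2 V))) ?_ ?_ ?_ ?_ ?_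
        · intro G _
          exact mem_powerset.2 (hsub G)
        · intro s _
          exact mem_univ _
        · intro G _
          simp
        · intro s hs
          ext e
          have := mem_powerset.1 hs
          simp only [SimpleGraph.mem_edgeFinset, SimpleGraph.edgeSet_fromEdgeSet, Set.mem_sdiff,
            mem_coe]
          constructor
          · exact fun h => h.1
          · intro h
            refine ⟨h, ?_⟩
            simpa [D] using this h
        · intro G _
          rw [hsingle, prod_mul_distrib, prod_const, prod_const, smul_eq_mul, prod_ite, prod_const,
            prod_const_one, mul_one]
          have h2 : #{e ∈ A | e ∈ G.edgeSet} = #{e ∈ G.edgeFinset | e ∈ A} := by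
            congr 1
            ext e
            simp [and_comm]
          rw [h2]
          ring
    _ = ∏ e ∈ D, ((p : ℝ) * (if e ∈ A then θ else 1) + (1 - p)) := (prod_add _ _ _).symm
    _ = ∏ e ∈ D, if e ∈ A then (1 - p + p * θ : ℝ) else 1 := by
        refine prod_congr rfl fun e _ => ?_
        split_ifs <;> ring
    _ = (1 - p + p * θ) ^ #A := by
        rw [prod_ite, prod_const, prod_const_one, mul_one, filter_mem_eq_inter,
          inter_eq_right.2 hAD]

/-- Markov's inequality on the finite probability space of graphs. -/
theorem measureReal_le_integral (p : unitInterval) {S : Set (SimpleGraph V)}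
    {φ : SimpleGraph V → ℝ} (h0 : ∀ G, 0 ≤ φ G) (h1 : ∀ G ∈ S, 1 ≤ φ G) :
    (SimpleGraph.binomialRandom V p).real S ≤ ∫ G, φ G ∂(SimpleGraph.binomialRandom V p) := by
  have h := mul_meas_ge_le_integral_of_nonneg (μ := SimpleGraph.binomialRandom V p)
    (f := φ) (.of_forall h0) .of_finite 1
  rw [one_mul] at h
  exact (measureReal_mono h1).trans h

open Classical in
/-- Chernoff's upper tail for the number of edges in a set of at most `m` pairs, before the choice
of the exponent `l`. -/
theorem measureReal_card_edges_gt_le (p : unitInterval) {A : Finset (Sym2 V)}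
    (hA : ∀ e ∈ A, ¬ e.IsDiag) {m l : ℝ} (hm : (#A : ℝ) ≤ m) (hl : 0 ≤ l) (t : ℝ) :
    (SimpleGraph.binomialRandom V p).real {G | t < #{e ∈ A | e ∈ G.edgeSet}} ≤
      Real.exp (p * m * (Real.exp l - 1) - l * t) := by
  have hp0 : (0 : ℝ) ≤ p := p.2.1
  calc (SimpleGraph.binomialRandom V p).real {G | t < #{e ∈ A | e ∈ G.edgeSet}}
      ≤ ∫ G, Real.exp (-(l * t)) * Real.exp l ^ #{e ∈ A | e ∈ G.edgeSet}
          ∂(SimpleGraph.binomialRandom V p) := by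
        refine measureReal_le_integral p (fun G => by positivity) fun G hG => ?_
        rw [← Real.exp_nat_mul, ← Real.exp_add, Real.one_le_exp_iff]
        have : l * t ≤ l * #{e ∈ A | e ∈ G.edgeSet} := mul_le_mul_of_nonneg_left hG.le hl
        linarith
    _ = Real.exp (-(l * t)) * (1 - p + p * Real.exp l) ^ #A := by
        rw [integral_const_mul, integral_pow_card_edges p A hA]
    _ ≤ Real.exp (-(l * t)) * Real.exp (p * m * (Real.exp l - 1)) := by
        have he : 0 ≤ Real.exp l - 1 := by linarith [Real.one_le_exp hl]
        have h1 : 1 - p + p * Real.exp l ≤ Real.exp (p * (Real.exp l - 1)) := by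
          linarith [Real.add_one_le_exp (p * (Real.exp l - 1) : ℝ)]
        have h0 : 0 ≤ 1 - p + p * Real.exp l := by nlinarith
        gcongr
        calc (1 - p + p * Real.exp l) ^ #A ≤ Real.exp (p * (Real.exp l - 1)) ^ #A := by gcongr
          _ = Real.exp (#A * (p * (Real.exp l - 1))) := by rw [Real.exp_nat_mul]
          _ ≤ Real.exp (p * m * (Real.exp l - 1)) := by
            rw [Real.exp_le_exp]
            have : 0 ≤ p * (Real.exp l - 1) := mul_nonneg hp0 he
            nlinarith
    _ = _ := by rw [← Real.exp_add]; ring_nf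

/-- The vertices outside `U` belong to the outer boundary of `U` independently of each other, each
with probability `1 - (1 - p) ^ #U`. The independence enters by writing `c ^ #∂U` as a sum, over
sets `X` outside `U`, of multiples of the indicator that no edge joins `U` to `X`. -/
theorem integral_pow_card_outerBoundary (p : unitInterval) (U : Finset V) (c : ℝ) :
    ∫ G, c ^ #(outerBoundary G U) ∂(SimpleGraph.binomialRandom V p) =
      ((1 - c) * (1 - p : ℝ) ^ #U + c) ^ (Fintype.card V - #U) := by
  classical
  let A : Finset V → Finset (Sym2 V) := fun X => (U ×ˢ X).image fun q => s(q.1, q.2)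
  have hApart : ∀ X ⊆ Uᶜ, (∀ e ∈ A X, ¬ e.IsDiag) ∧ #(A X) = #U * #X := by
    intro X hX
    have hdisj : ∀ u ∈ U, ∀ x ∈ X, u ≠ x := fun u hu x hx h =>
      mem_compl.1 (hX hx) (h ▸ hu)
    constructor
    · intro e he
      obtain ⟨⟨u, x⟩, hq, rfl⟩ := mem_image.1 he
      obtain ⟨hu, hx⟩ := mem_product.1 hq
      simpa using hdisj u hu x hx
    · rw [card_image_of_injOn, card_product]
      rintro ⟨u, x⟩ hq ⟨u', x'⟩ hq' h
      obtain ⟨hu, hx⟩ := mem_product.1 hq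
      obtain ⟨hu', hx'⟩ := mem_product.1 hq'
      rcases Sym2.eq_iff.1 h with ⟨h1, h2⟩ | ⟨h1, h2⟩
      · exact Prod.ext h1 h2
      · exact absurd h1 (hdisj u hu x' hx')
  have hpt : ∀ G : SimpleGraph V, c ^ #(outerBoundary G U) =
      ∑ X ∈ Uᶜ.powerset, ((1 - c) ^ #X * c ^ #(Uᶜ \ X)) *
        (0 : ℝ) ^ #{e ∈ A X | e ∈ G.edgeSet} := by
    intro G
    have h1 : outerBoundary G U = {x ∈ Uᶜ | ∃ u ∈ U, G.Adj u x} := by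
      ext x
      simp [mem_outerBoundary]
    calc c ^ #(outerBoundary G U)
        = ∏ x ∈ Uᶜ, ((1 - c) * (if ∃ u ∈ U, G.Adj u x then 0 else 1) + c) := by
          rw [h1, ← prod_const, prod_filter]
          refine prod_congr rfl fun x _ => ?_
          split_ifs <;> ring
      _ = ∑ X ∈ Uᶜ.powerset, (∏ x ∈ X, (1 - c) * (if ∃ u ∈ U, G.Adj u x then 0 else 1)) *
            ∏ _x ∈ Uᶜ \ X, c := prod_add _ _ _
      _ = _ := by
          refine sum_congr rfl fun X hX => ?_
          rw [prod_mul_distrib, prod_const, prod_const, mul_right_comm]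
          congr 1
          by_cases h : ∃ x ∈ X, ∃ u ∈ U, G.Adj u x
          · obtain ⟨x, hx, hu⟩ := h
            rw [prod_eq_zero (f := fun x => if ∃ u ∈ U, G.Adj u x then (0 : ℝ) else 1) hx (if_pos hu),
              zero_pow]
            obtain ⟨u, hu, hux⟩ := hu
            refine (card_pos.2 ⟨s(u, x), mem_filter.2 ⟨?_, hux⟩⟩).ne'
            exact mem_image.2 ⟨(u, x), mem_product.2 ⟨hu, hx⟩, rfl⟩
          · rw [prod_eq_one (f := fun x => if ∃ u ∈ U, G.Adj u x then (0 : ℝ) else 1)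
              fun x hx => if_neg fun hu => h ⟨x, hx, hu⟩, filter_eq_empty_iff.2]
            · simp
            · intro e he heG
              obtain ⟨⟨u, x⟩, hq, rfl⟩ := mem_image.1 he
              obtain ⟨hu, hx⟩ := mem_product.1 hq
              exact h ⟨x, hx, u, hu, heG⟩
  simp_rw [hpt]
  rw [integral_finsetSum _ fun _ _ => .of_finite]
  calc ∑ X ∈ Uᶜ.powerset, ∫ G, ((1 - c) ^ #X * c ^ #(Uᶜ \ X)) *
        (0 : ℝ) ^ #{e ∈ A X | e ∈ G.edgeSet} ∂(SimpleGraph.binomialRandom V p)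
      = ∑ X ∈ Uᶜ.powerset, (∏ _x ∈ X, ((1 - c) * (1 - p : ℝ) ^ #U)) * ∏ _x ∈ Uᶜ \ X, c := by
        refine sum_congr rfl fun X hX => ?_
        obtain ⟨hdiag, hcard⟩ := hApart X (mem_powerset.1 hX)
        rw [integral_const_mul, integral_pow_card_edges p _ hdiag, hcard, prod_const, prod_const,
          mul_pow, ← pow_mul]
        ring
    _ = _ := by rw [← prod_add, prod_const, card_compl]

end RandomGraph

/-! ### Degrees, expansion and sparsity of the random graph -/

section Typical

variable {V : Type*} [Fintype V]

open Classical in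
/-- The edges of `G` with both ends in `U`. -/
noncomputable def insideEdges (G : SimpleGraph V) (U : Finset V) : Finset (Sym2 V) :=
  {e | e ∈ G.edgeSet ∧ ∀ u ∈ e, u ∈ U}

theorem mem_insideEdges {G : SimpleGraph V} {U : Finset V} {e : Sym2 V} :
    e ∈ insideEdges G U ↔ e ∈ G.edgeSet ∧ ∀ u ∈ e, u ∈ U := by
  simp [insideEdges]

/-- The properties of a typical random graph of expected degree `d` and edge probability `p` on
which the cops rely: degrees are at most `d (1 + ε)`, small sets expand by almost the factor `d`,
and no vertex set spans many more edges than expected. -/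
structure IsTypical (G : SimpleGraph V) (d p ε L : ℝ) : Prop where
  degree_le : ∀ v, (#(outerBoundary G {v}) : ℝ) ≤ d * (1 + ε)
  le_boundary : ∀ U : Finset V, U.Nonempty → #U * d ≤ Fintype.card V / 2 →
    #U * d * (1 - ε - #U * d / Fintype.card V) ≤ #(outerBoundary G U)
  inside_le : ∀ U : Finset V, U.Nonempty → (#(insideEdges G U) : ℝ) ≤ #U * (3 * L + 2 * p * #U)

theorem exp_neg_three_mul_log {n : ℝ} (hn : 0 < n) :
    Real.exp (-(3 * Real.log n)) = (n ^ 3)⁻¹ := by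
  rw [Real.exp_neg, show (3 : ℝ) * Real.log n = ((3 : ℕ) : ℝ) * Real.log n by norm_num,
    Real.exp_nat_mul, Real.exp_log hn]

theorem sum_pow_card_nonempty_le {x : ℝ} (hx : 0 ≤ x) (hx1 : Fintype.card V * x ≤ 1) :
    ∑ U : Finset V with U.Nonempty, x ^ #U ≤ 2 * (Fintype.card V * x) := by
  classical
  have h1 : ∑ U : Finset V, x ^ #U = (x + 1) ^ Fintype.card V := by
    simpa using Fintype.sum_pow_mul_eq_add_pow V x 1
  have h2 : ∑ U : Finset V with U.Nonempty, x ^ #U + 1 = ∑ U : Finset V, x ^ #U := by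
    rw [← sum_filter_add_sum_filter_not univ (fun U : Finset V => U.Nonempty)]
    congr 1
    have : ({U | ¬ U.Nonempty} : Finset (Finset V)) = {∅} := by
      ext U
      simp [not_nonempty_iff_eq_empty]
    rw [this]
    simp
  have h3 : (x + 1) ^ Fintype.card V ≤ Real.exp (Fintype.card V * x) := by
    rw [Real.exp_nat_mul]
    gcongr
    exact Real.add_one_le_exp x
  have h0 : 0 ≤ Fintype.card V * x := by positivity
  have h4 := (abs_le.1 (Real.abs_exp_sub_one_sub_id_le (x := Fintype.card V * x)
    (by rwa [abs_of_nonneg h0]))).2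
  nlinarith

/-- Union bound over all nonempty vertex sets. -/
theorem measureReal_exists_nonempty_le (p : unitInterval) (S : Finset V → Set (SimpleGraph V))
    {x : ℝ} (hx : 0 ≤ x) (hx1 : Fintype.card V * x ≤ 1)
    (hS : ∀ U, U.Nonempty → (SimpleGraph.binomialRandom V p).real (S U) ≤ x ^ #U) :
    (SimpleGraph.binomialRandom V p).real {G | ∃ U, U.Nonempty ∧ G ∈ S U} ≤
      2 * (Fintype.card V * x) := by
  classical
  have h : {G | ∃ U, U.Nonempty ∧ G ∈ S U} = ⋃ U ∈ ({U | U.Nonempty} : Finset (Finset V)), S U := by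
    ext G
    simp
  rw [h]
  refine (measureReal_biUnion_finset_le _ _).trans (le_trans (sum_le_sum fun U hU => ?_)
    (sum_pow_card_nonempty_le hx hx1))
  exact hS U (by simpa using hU)

theorem one_sub_pow_le {p : ℝ} (h0 : 0 ≤ p) (h1 : p ≤ 1) (k : ℕ) :
    (1 - p) ^ k ≤ 1 - k * p + (k * p) ^ 2 / 2 := by
  induction k with
  | zero => simp
  | succ k ih =>
    have h := mul_le_mul_of_nonneg_right ih (sub_nonneg.2 h1)
    rw [← pow_succ] at h
    refine h.trans ?_
    push_cast
    have : 0 ≤ ((k : ℝ) * p) ^ 2 * p := by positivity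
    nlinarith [sq_nonneg p]

/-- A lower bound for the expected size of the outer boundary of a set of `k` vertices. -/
theorem mul_le_mul_one_sub_pow {p d n : ℝ} {k : ℕ} (h0 : 0 ≤ p) (h1 : p ≤ 1)
    (hd : d = p * (n - 1)) (hd4 : 4 ≤ d) (hn : 4 ≤ n) (hk : 1 ≤ k) (hkn : k ≤ n) :
    k * d * (1 - k * d / n) ≤ (n - k) * (1 - (1 - p) ^ k) := by
  have hk1 : (1 : ℝ) ≤ k := by exact_mod_cast hk
  have hb := one_sub_pow_le h0 h1 k
  have hkd : (k : ℝ) * d / n ≤ k * d / 4 := by gcongr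
  have h2 : (n - 1) * (1 - k * d / n) ≤ n - k - k * d / 2 := by
    have : (n - 1) * (1 - k * d / n) = n - 1 - k * d + k * d / n := by
      field_simp
      ring
    rw [this]
    nlinarith
  have h3 : n - k - k * d / 2 ≤ (n - k) * (1 - k * p / 2) := by
    rw [hd]
    have : 0 ≤ (k - 1) * (k * p) := by
      have : 0 ≤ (k : ℝ) - 1 := by linarith
      positivity
    nlinarith
  have hkp : 0 ≤ k * p := by positivity
  calc k * d * (1 - k * d / n) = k * p * ((n - 1) * (1 - k * d / n)) := by rw [hd]; ring
    _ ≤ k * p * ((n - k) * (1 - k * p / 2)) := mul_le_mul_of_nonneg_left (h2.trans h3) hkp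
    _ = (n - k) * (k * p - (k * p) ^ 2 / 2) := by ring
    _ ≤ (n - k) * (1 - (1 - p) ^ k) := by
      have : 0 ≤ n - k := by linarith
      refine mul_le_mul_of_nonneg_left ?_ this
      linarith

/-- Chernoff's lower tail for the outer boundary of `U`. -/
theorem measureReal_outerBoundary_lt_le (p : unitInterval) {d ε : ℝ} {U : Finset V}
    (hd : d = p * ((Fintype.card V : ℝ) - 1)) (hd4 : 4 ≤ d) (hn : 4 ≤ Fintype.card V)
    (hU : U.Nonempty) (hε0 : 0 ≤ ε) (hε1 : ε ≤ 1) (hUd : #U * d ≤ Fintype.card V / 2) :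
    (SimpleGraph.binomialRandom V p).real
        {G | #(outerBoundary G U) < #U * d * (1 - ε - #U * d / Fintype.card V)} ≤
      Real.exp (-(#U * (ε ^ 2 * d / 4))) := by
  set n : ℝ := (Fintype.card V : ℝ) with hn_def
  have hn4 : (4 : ℝ) ≤ n := by rw [hn_def]; exact_mod_cast hn
  -- The exponent `ε / 2` is half the optimal one; it allows the cruder bound `exp (-l) ≤ 1 - l + l ^ 2`.
  set l : ℝ := ε / 2 with hl
  set y : ℝ := #U * d / n with hy
  set c : ℝ := Real.exp (-l) with hc
  set q : ℝ := (1 - p : ℝ) ^ #U with hq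
  have hp0 : (0 : ℝ) ≤ p := p.2.1
  have hp1 : (p : ℝ) ≤ 1 := p.2.2
  have hl0 : 0 ≤ l := by positivity
  have hkn : #U ≤ Fintype.card V := card_le_univ U
  have hkn' : (#U : ℝ) ≤ n := by rw [hn_def]; exact_mod_cast hkn
  have hy1 : y ≤ 1 := by
    rw [hy, div_le_one (by linarith)]
    linarith
  have hy0 : 0 ≤ y := by positivity
  have hc1 : c ≤ 1 - l + l ^ 2 := by
    have := (abs_le.1 (Real.abs_exp_sub_one_sub_id_le (x := -l)
      (by rw [abs_neg, abs_of_nonneg hl0]; linarith))).2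
    linarith [neg_sq l]
  have hmean := mul_le_mul_one_sub_pow (n := n) hp0 hp1 hd hd4 hn4 hU.card_pos hkn'
  have hq1 : q ≤ 1 := pow_le_one₀ (by linarith) (by linarith)
  have hq0 : 0 ≤ q := pow_nonneg (by linarith) _
  have hc1' : c ≤ 1 := Real.exp_le_one_iff.2 (by linarith)
  have hc0 : 0 ≤ c := (Real.exp_pos _).le
  set t : ℝ := #U * d * (1 - ε - y) with ht
  calc (SimpleGraph.binomialRandom V p).real {G | #(outerBoundary G U) < t}
      ≤ ∫ G, Real.exp (l * t) * c ^ #(outerBoundary G U) ∂(SimpleGraph.binomialRandom V p) := by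
        refine measureReal_le_integral p (fun G => by positivity) fun G hG => ?_
        rw [hc, ← Real.exp_nat_mul, ← Real.exp_add, Real.one_le_exp_iff]
        have : l * #(outerBoundary G U) ≤ l * t :=
          mul_le_mul_of_nonneg_left (Set.mem_ofPred_eq ▸ hG).le hl0
        linarith
    _ = Real.exp (l * t) * ((1 - c) * q + c) ^ (Fintype.card V - #U) := by
        rw [integral_const_mul, integral_pow_card_outerBoundary]
    _ ≤ Real.exp (l * t) * Real.exp (-((1 - c) * (1 - q))) ^ (Fintype.card V - #U) := by
        have h1 : 0 ≤ (1 - c) * q + c := by nlinarith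
        have h2 : (1 - c) * q + c ≤ Real.exp (-((1 - c) * (1 - q))) := by
          linarith [Real.add_one_le_exp (-((1 - c) * (1 - q)))]
        gcongr
    _ = Real.exp (l * t - (1 - c) * ((n - #U) * (1 - q))) := by
        rw [← Real.exp_nat_mul, ← Real.exp_add, Nat.cast_sub hkn, ← hn_def]
        ring_nf
    _ ≤ Real.exp (-(#U * (ε ^ 2 * d / 4))) := by
        rw [Real.exp_le_exp]
        have hkd : 0 ≤ #U * d := by positivity
        have h1 : (l - l ^ 2) * (#U * d * (1 - y)) ≤ (1 - c) * ((n - #U) * (1 - q)) := by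
          have h10 : 0 ≤ #U * d * (1 - y) := mul_nonneg hkd (by linarith)
          have h11 : l - l ^ 2 ≤ 1 - c := by linarith
          have h12 : 0 ≤ 1 - c := by linarith
          exact (mul_le_mul_of_nonneg_right h11 h10).trans (mul_le_mul_of_nonneg_left hmean h12)
        have h2 : l * t - (l - l ^ 2) * (#U * d * (1 - y)) =
            -(#U * (ε ^ 2 * d / 4)) - #U * d * (l ^ 2 * y) := by
          rw [ht, hl]
          ring
        have h3 : 0 ≤ #U * d * (l ^ 2 * y) := by positivity
        linarith

theorem measureReal_degree_gt_le (p : unitInterval) {d ε : ℝ} (v : V)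
    (hd : d = p * ((Fintype.card V : ℝ) - 1)) (hε0 : 0 ≤ ε) (hε1 : ε ≤ 1) :
    (SimpleGraph.binomialRandom V p).real {G | d * (1 + ε) < #(outerBoundary G {v})} ≤
      Real.exp (-(ε ^ 2 * d / 4)) := by
  classical
  let A : Finset (Sym2 V) := (univ.erase v).image fun w => s(v, w)
  have hA : ∀ e ∈ A, ¬ e.IsDiag := by
    intro e he
    obtain ⟨w, hw, rfl⟩ := mem_image.1 he
    simpa using (ne_of_mem_erase hw).symm
  have hpos : 0 < Fintype.card V := Fintype.card_pos_iff.2 ⟨v⟩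
  have hcard : (#A : ℝ) ≤ (Fintype.card V : ℝ) - 1 := by
    have h : #A ≤ Fintype.card V - 1 := by
      refine card_image_le.trans ?_
      rw [card_erase_of_mem (mem_univ v), card_univ]
    have h' : (#A : ℝ) ≤ (Fintype.card V - 1 : ℕ) := by exact_mod_cast h
    rwa [Nat.cast_pred hpos] at h'
  have hdeg : ∀ G : SimpleGraph V, #(outerBoundary G {v}) ≤ #{e ∈ A | e ∈ G.edgeSet} := by
    intro G
    refine card_le_card_of_injOn (fun w => s(v, w)) ?_ ?_
    · intro w hw
      have hw' := mem_outerBoundary.1 (mem_coe.1 hw)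
      simp only [mem_singleton, exists_eq_left] at hw'
      refine mem_coe.2 (mem_filter.2 ⟨mem_image.2 ⟨w, ?_, rfl⟩, hw'.2⟩)
      exact mem_erase.2 ⟨hw'.1, mem_univ w⟩
    · intro w _ w' _ h
      rcases Sym2.eq_iff.1 h with ⟨-, h⟩ | ⟨h1, h2⟩
      · exact h
      · exact h2.trans h1
  have hd0 : 0 ≤ d := by
    rw [hd]
    have : (1 : ℝ) ≤ Fintype.card V := by exact_mod_cast hpos
    exact mul_nonneg p.2.1 (by linarith)
  calc (SimpleGraph.binomialRandom V p).real {G | d * (1 + ε) < #(outerBoundary G {v})}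
      ≤ (SimpleGraph.binomialRandom V p).real
          {G | d * (1 + ε) < #{e ∈ A | e ∈ G.edgeSet}} := by
        refine measureReal_mono fun G hG => ?_
        have h : (#(outerBoundary G {v}) : ℝ) ≤ #{e ∈ A | e ∈ G.edgeSet} := by
          exact_mod_cast hdeg G
        exact lt_of_lt_of_le hG h
    _ ≤ Real.exp (p * ((Fintype.card V : ℝ) - 1) * (Real.exp (ε / 2) - 1) -
          ε / 2 * (d * (1 + ε))) :=
        measureReal_card_edges_gt_le p hA hcard (by positivity) _
    _ ≤ Real.exp (-(ε ^ 2 * d / 4)) := by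
        rw [Real.exp_le_exp, ← hd]
        have h := (abs_le.1 (Real.abs_exp_sub_one_sub_id_le (x := ε / 2)
          (by rw [abs_of_nonneg (by positivity)]; linarith))).2
        have h' : d * (Real.exp (ε / 2) - 1) ≤ d * (ε / 2 + (ε / 2) ^ 2) := by
          gcongr
          linarith
        nlinarith

theorem measureReal_insideEdges_gt_le (p : unitInterval) (L : ℝ) (U : Finset V) :
    (SimpleGraph.binomialRandom V p).real
        {G | #U * (3 * L + 2 * p * #U) < #(insideEdges G U)} ≤
      Real.exp (-(3 * L)) ^ #U := by
  classical
  let A : Finset (Sym2 V) := {e | ¬ e.IsDiag ∧ ∀ u ∈ e, u ∈ U}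
  have hA : ∀ e ∈ A, ¬ e.IsDiag := fun e he => (mem_filter.1 he).2.1
  have hcard : (#A : ℝ) ≤ (#U : ℝ) ^ 2 := by
    have hsub : A ⊆ (U ×ˢ U).image fun q => s(q.1, q.2) := by
      intro e he
      induction e with
      | h a b =>
        have h := (mem_filter.1 he).2.2
        exact mem_image.2 ⟨(a, b), mem_product.2
          ⟨h a (Sym2.mem_mk_left a b), h b (Sym2.mem_mk_right a b)⟩, rfl⟩
    have h : #A ≤ #U ^ 2 := by
      refine (card_le_card hsub).trans (card_image_le.trans ?_)
      rw [card_product, sq]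
    exact_mod_cast h
  have hin : ∀ G : SimpleGraph V, insideEdges G U = {e ∈ A | e ∈ G.edgeSet} := by
    intro G
    ext e
    simp only [mem_insideEdges, A, mem_filter, mem_univ, true_and]
    exact ⟨fun h => ⟨⟨G.not_isDiag_of_mem_edgeSet h.1, h.2⟩, h.1⟩, fun h => ⟨h.2, h.1.2⟩⟩
  simp_rw [hin]
  refine (measureReal_card_edges_gt_le p hA hcard zero_le_one _).trans ?_
  rw [← Real.exp_nat_mul, Real.exp_le_exp]
  have he : Real.exp 1 - 1 ≤ 2 := by linarith [Real.exp_one_lt_d9]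
  have h : p * (#U : ℝ) ^ 2 * (Real.exp 1 - 1) ≤ p * (#U : ℝ) ^ 2 * 2 :=
    mul_le_mul_of_nonneg_left he (mul_nonneg p.2.1 (by positivity))
  nlinarith

/-- A random graph fails to be typical with probability `O(n⁻²)`, where `L = log n`. -/
theorem measureReal_not_isTypical_le (p : unitInterval) {d ε L : ℝ}
    (hd : d = p * ((Fintype.card V : ℝ) - 1)) (hd4 : 4 ≤ d) (hn : 4 ≤ Fintype.card V)
    (hε0 : 0 ≤ ε) (hε1 : ε ≤ 1) (hL : L = Real.log (Fintype.card V))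
    (hεd : 12 * L ≤ ε ^ 2 * d) :
    (SimpleGraph.binomialRandom V p).real {G | ¬ IsTypical G d p ε L} ≤
      5 / (Fintype.card V : ℝ) ^ 2 := by
  set n : ℝ := (Fintype.card V : ℝ) with hn_def
  have hn4 : (4 : ℝ) ≤ n := by rw [hn_def]; exact_mod_cast hn
  set x : ℝ := Real.exp (-(3 * L)) with hx
  have hxn : x = (n ^ 3)⁻¹ := by rw [hx, hL, exp_neg_three_mul_log (by linarith)]
  have hnx : n * x = 1 / n ^ 2 := by
    rw [hxn]
    field_simp
  have hx0 : 0 ≤ x := (Real.exp_pos _).le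
  have hnx1 : n * x ≤ 1 := by
    rw [hnx, div_le_one (by positivity)]
    nlinarith
  have hdx : Real.exp (-(ε ^ 2 * d / 4)) ≤ x := by
    rw [hx, Real.exp_le_exp]
    linarith
  let S₁ : Set (SimpleGraph V) := ⋃ v ∈ (univ : Finset V), {G | d * (1 + ε) < #(outerBoundary G {v})}
  let S₂ : Set (SimpleGraph V) := {G | ∃ U : Finset V, U.Nonempty ∧ G ∈ {G : SimpleGraph V |
    #U * d ≤ n / 2 ∧ #(outerBoundary G U) < #U * d * (1 - ε - #U * d / n)}}
  let S₃ : Set (SimpleGraph V) := {G | ∃ U : Finset V, U.Nonempty ∧ G ∈ {G : SimpleGraph V |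
    #U * (3 * L + 2 * p * #U) < #(insideEdges G U)}}
  have h1 : (SimpleGraph.binomialRandom V p).real S₁ ≤ n * x := by
    refine (measureReal_biUnion_finset_le _ _).trans ?_
    calc _ ≤ ∑ _v : V, x :=
          sum_le_sum fun v _ => (measureReal_degree_gt_le p v hd hε0 hε1).trans hdx
      _ = n * x := by simp [hn_def]
  have h2 : (SimpleGraph.binomialRandom V p).real S₂ ≤ 2 * (n * x) := by
    refine measureReal_exists_nonempty_le p _ hx0 hnx1 fun U hU => ?_
    by_cases hUd : #U * d ≤ n / 2
    · refine (measureReal_mono fun G hG => hG.2).trans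
        ((measureReal_outerBoundary_lt_le p hd hd4 hn hU hε0 hε1 hUd).trans ?_)
      rw [hx, ← Real.exp_nat_mul, Real.exp_le_exp]
      have : (#U : ℝ) * (3 * L) ≤ #U * (ε ^ 2 * d / 4) := by
        gcongr
        linarith
      linarith
    · simp only [hUd, false_and, Set.ofPred_false, measureReal_empty]
      positivity
  have h3 : (SimpleGraph.binomialRandom V p).real S₃ ≤ 2 * (n * x) :=
    measureReal_exists_nonempty_le p _ hx0 hnx1 fun U _ => measureReal_insideEdges_gt_le p L U
  have hsub : {G | ¬ IsTypical G d p ε L} ⊆ S₁ ∪ S₂ ∪ S₃ := by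
    intro G hG
    by_contra hnot
    simp only [S₁, S₂, S₃, Set.mem_union, not_or, Set.mem_iUnion, Set.mem_ofPred_eq, not_exists,
      not_and, not_lt, mem_univ, true_imp_iff] at hnot
    exact hG ⟨hnot.1.1, hnot.1.2, hnot.2⟩
  calc _ ≤ (SimpleGraph.binomialRandom V p).real (S₁ ∪ S₂ ∪ S₃) := measureReal_mono hsub
    _ ≤ n * x + 2 * (n * x) + 2 * (n * x) :=
      (measureReal_union_le _ _).trans
        (add_le_add ((measureReal_union_le _ _).trans (add_le_add h1 h2)) h3)
    _ = 5 / n ^ 2 := by rw [hnx]; ring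

end Typical

/-! ### Growth of balls in a typical graph -/

section Growth

variable {V : Type*} [Fintype V] {G : SimpleGraph V} {d p ε L : ℝ}

theorem four_le_of_one_le_mul (hε0 : 0 ≤ ε) (hε : ε ≤ 1 / 4) (hd : 1 ≤ ε * d) : 4 ≤ d := by
  have hd0 : 0 < d := by
    by_contra! h
    nlinarith
  nlinarith

/-- One layer of growth, from a lower bound `a` on the size of the ball of radius `j`. -/
theorem IsTypical.le_card_ball_succ (hG : IsTypical G d p ε L) (hd : 0 ≤ d) (hε : ε ≤ 1 / 4)
    {U : Finset V} {j : ℕ} {a : ℝ} (ha1 : 1 ≤ a) (ha : a ≤ #(ball G U j))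
    (had : 2 * (a * d) ≤ Fintype.card V / 2) :
    a * d * (1 - ε - 2 * (a * d) / Fintype.card V) ≤ #(ball G U (j + 1)) := by
  classical
  set n : ℝ := (Fintype.card V : ℝ) with hn
  -- Expansion is only known for small sets, so it is applied to a subset of `⌈a⌉ ≤ 2 a` vertices.
  obtain ⟨W, hW, hWcard⟩ := exists_subset_card_eq (Nat.ceil_le.2 ha)
  have hWa : a ≤ #W := hWcard ▸ Nat.le_ceil a
  have hWa2 : (#W : ℝ) ≤ 2 * a := by
    rw [hWcard]
    linarith [Nat.ceil_lt_add_one (zero_le_one.trans ha1)]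
  have hWne : W.Nonempty := by
    rw [← card_pos, hWcard]
    exact Nat.ceil_pos.2 (by linarith)
  have hWd : #W * d ≤ 2 * (a * d) := by nlinarith
  have hsub : outerBoundary G W ⊆ ball G U (j + 1) := by
    intro x hx
    obtain ⟨-, u, hu, hux⟩ := mem_outerBoundary.1 hx
    exact mem_ball_succ.2 (Or.inr ⟨u, hW hu, hux⟩)
  have hn0 : 0 ≤ n := by positivity
  have hq : 2 * (a * d) / n ≤ 1 / 2 := by
    rcases hn0.eq_or_lt with h | h
    · rw [← h]
      norm_num
    · rw [div_le_iff₀ h]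
      linarith
  calc a * d * (1 - ε - 2 * (a * d) / n) ≤ #W * d * (1 - ε - #W * d / n) := by
        have h1 : #W * d / n ≤ 2 * (a * d) / n := by gcongr
        have h2 : a * d ≤ #W * d := by gcongr
        exact mul_le_mul h2 (by linarith) (by linarith) (by positivity)
    _ ≤ #(outerBoundary G W) := hG.le_boundary W hWne (hWd.trans had)
    _ ≤ #(ball G U (j + 1)) := by exact_mod_cast card_le_card hsub

/-- Balls of radius `r` around small sets `U` have almost `#U * d ^ r` vertices. In all layers but
the last the loss is a factor `1 - 2ε`; in the last one it is a constant. -/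
theorem IsTypical.le_card_ball (hG : IsTypical G d p ε L) (hε0 : 0 ≤ ε) (hε : ε ≤ 1 / 4)
    (hd : 1 ≤ ε * d) {r : ℕ} (hr : 1 ≤ r) (hrε : r * ε ≤ 1 / 4) {U : Finset V} (hU : U.Nonempty)
    (hUd : #U * d ^ r ≤ Fintype.card V / 4) :
    #U * d ^ r / 8 ≤ #(ball G U r) := by
  set n : ℝ := (Fintype.card V : ℝ) with hn
  obtain ⟨s, rfl⟩ : ∃ s, r = s + 1 := ⟨r - 1, by omega⟩
  have hd4 : 4 ≤ d := four_le_of_one_le_mul hε0 hε hd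
  have hn0 : 0 < n := by
    rw [hn]
    exact_mod_cast Fintype.card_pos_iff.2 ⟨hU.choose⟩
  have hU1 : (1 : ℝ) ≤ #U := by exact_mod_cast hU.card_pos
  have hfac : 1 ≤ d * (1 - 2 * ε) := by nlinarith
  have hfacd : d * (1 - 2 * ε) ≤ d := by nlinarith
  have hfac0 : 0 ≤ d * (1 - 2 * ε) := by linarith
  have hone : ∀ j : ℕ, 1 ≤ #U * (d * (1 - 2 * ε)) ^ j := fun j =>
    one_le_mul_of_one_le_of_one_le hU1 (one_le_pow₀ hfac)
  have hupper : ∀ j : ℕ, #U * (d * (1 - 2 * ε)) ^ j * d ≤ #U * d ^ (j + 1) := fun j => by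
    rw [pow_succ, mul_assoc]
    gcongr
  have hmono : ∀ j ≤ s, (#U : ℝ) * d ^ (j + 1) ≤ #U * d ^ (s + 1) := fun j hj => by
    gcongr
    linarith
  have hlayers : ∀ j ≤ s, #U * (d * (1 - 2 * ε)) ^ j ≤ #(ball G U j) := by
    intro j
    induction j with
    | zero => simp [ball]
    | succ j ih =>
      intro hj
      have hj' := hmono j (by omega)
      have h1 := hupper j
      have hstep := hG.le_card_ball_succ (by linarith) hε (hone j) (ih (by omega))
        (by rw [← hn]; linarith)
      rw [← hn] at hstep
      refine le_trans ?_ hstep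
      have hloss : 2 * (#U * (d * (1 - 2 * ε)) ^ j * d) / n ≤ ε := by
        rw [div_le_iff₀ hn0]
        have h2 : (#U : ℝ) * d ^ (j + 1) * d ≤ n / 4 := by
          rw [mul_assoc, ← pow_succ]
          exact (hmono (j + 1) hj).trans hUd
        have h3 : 0 ≤ (#U : ℝ) * d ^ (j + 1) := by positivity
        calc 2 * (#U * (d * (1 - 2 * ε)) ^ j * d) ≤ 2 * (#U * d ^ (j + 1)) := by linarith
          _ ≤ 2 * (#U * d ^ (j + 1)) * (ε * d) := by nlinarith
          _ = 2 * ε * (#U * d ^ (j + 1) * d) := by ring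
          _ ≤ 2 * ε * (n / 4) := by gcongr
          _ ≤ ε * n := by nlinarith
      calc #U * (d * (1 - 2 * ε)) ^ (j + 1)
          = #U * (d * (1 - 2 * ε)) ^ j * d * (1 - ε - ε) := by ring
        _ ≤ _ := by
          have : 0 ≤ #U * (d * (1 - 2 * ε)) ^ j * d := by positivity
          gcongr
  have hlast := hG.le_card_ball_succ (by linarith) hε (hone s) (hlayers s le_rfl)
    (by rw [← hn]; linarith [hupper s])
  rw [← hn] at hlast
  refine le_trans ?_ hlast
  have hloss : 2 * (#U * (d * (1 - 2 * ε)) ^ s * d) / n ≤ 1 / 2 := by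
    rw [div_le_iff₀ hn0]
    linarith [hupper s]
  have hbern : 1 / 2 ≤ (1 - 2 * ε) ^ s := by
    have h := one_add_mul_le_pow (a := -(2 * ε)) (by linarith) s
    push_cast at hrε
    rw [← sub_eq_add_neg] at h
    linarith
  have h0 : 0 ≤ (#U : ℝ) * d ^ (s + 1) := by positivity
  calc #U * d ^ (s + 1) / 8 ≤ #U * d ^ (s + 1) * (1 - 2 * ε) ^ s * (1 / 4) := by nlinarith
    _ = #U * (d * (1 - 2 * ε)) ^ s * d * (1 / 4) := by rw [mul_pow]; ring
    _ ≤ _ := by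
      have : 0 ≤ #U * (d * (1 - 2 * ε)) ^ s * d := by positivity
      refine mul_le_mul_of_nonneg_left ?_ this
      linarith

/-- Each layer multiplies the size by at most `1 + d (1 + ε) ≤ d (1 + 2ε)`, and
`(1 + 2ε) ^ r ≤ exp (1 / 2)`. -/
theorem IsTypical.card_ball_le (hG : IsTypical G d p ε L) (hε0 : 0 ≤ ε) (hd : 1 ≤ ε * d)
    {r : ℕ} (hrε : r * ε ≤ 1 / 4) (v : V) : #(ball G {v} r) ≤ 2 * d ^ r := by
  classical
  have hd0 : 0 < d := by
    by_contra! h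
    nlinarith
  have hfac : 0 ≤ d * (1 + 2 * ε) := by positivity
  have hlayers : ∀ j, (#(ball G {v} j) : ℝ) ≤ (d * (1 + 2 * ε)) ^ j := by
    intro j
    induction j with
    | zero => simp [ball]
    | succ j ih =>
      have hsub : outerBoundary G (ball G {v} j) ⊆
          (ball G {v} j).biUnion fun u => outerBoundary G {u} := by
        intro x hx
        obtain ⟨hx, u, hu, hux⟩ := mem_outerBoundary.1 hx
        refine mem_biUnion.2 ⟨u, hu, mem_outerBoundary.2 ⟨?_, u, mem_singleton_self u, hux⟩⟩
        exact fun h => hux.ne (mem_singleton.1 h).symm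
      have hcard : (#(outerBoundary G (ball G {v} j)) : ℝ) ≤
          ∑ u ∈ ball G {v} j, d * (1 + ε) := by
        calc (#(outerBoundary G (ball G {v} j)) : ℝ)
            ≤ ∑ u ∈ ball G {v} j, (#(outerBoundary G {u}) : ℝ) := by
              exact_mod_cast (card_le_card hsub).trans card_biUnion_le
          _ ≤ _ := sum_le_sum fun u _ => hG.degree_le u
      rw [sum_const, nsmul_eq_mul] at hcard
      rw [card_ball_succ, Nat.cast_add, pow_succ]
      calc (#(ball G {v} j) : ℝ) + #(outerBoundary G (ball G {v} j))
          ≤ #(ball G {v} j) * (d * (1 + 2 * ε)) := by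
            have : (#(ball G {v} j) : ℝ) ≤ #(ball G {v} j) * (ε * d) :=
              le_mul_of_one_le_right (by positivity) hd
            linarith
        _ ≤ _ := by gcongr
  have hexp : (1 + 2 * ε) ^ r ≤ 2 := by
    calc (1 + 2 * ε) ^ r ≤ Real.exp (2 * ε) ^ r := by
          gcongr
          linarith [Real.add_one_le_exp (2 * ε)]
      _ = Real.exp (r * (2 * ε)) := (Real.exp_nat_mul _ _).symm
      _ ≤ Real.exp (1 / 2) := by
          rw [Real.exp_le_exp]
          linarith
      _ ≤ 2 := by
          have h := (abs_le.1 (Real.abs_exp_sub_one_sub_id_le (x := 1 / 2)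
            (by norm_num [abs_of_pos]))).2
          linarith
  calc (#(ball G {v} r) : ℝ) ≤ (d * (1 + 2 * ε)) ^ r := hlayers r
    _ = d ^ r * (1 + 2 * ε) ^ r := mul_pow _ _ _
    _ ≤ d ^ r * 2 := by gcongr
    _ = 2 * d ^ r := mul_comm _ _

theorem IsTypical.card_edges_le (hG : IsTypical G d p ε L) {B : Finset V} {A : Finset (Sym2 V)}
    (hA : ∀ e ∈ A, e ∈ G.edgeSet ∧ ∃ u ∈ B, u ∈ e) : (#A : ℝ) ≤ #B * (d * (1 + ε)) := by
  classical
  have hsub : A ⊆ B.biUnion fun u => (outerBoundary G {u}).image fun x => s(u, x) := by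
    intro e he
    obtain ⟨heG, u, hu, hue⟩ := hA e he
    obtain ⟨x, rfl⟩ := Sym2.mem_iff_exists.1 hue
    refine mem_biUnion.2 ⟨u, hu, mem_image.2 ⟨x, mem_outerBoundary.2 ⟨?_, u, ?_, heG⟩, rfl⟩⟩
    · exact fun h => G.ne_of_adj heG (mem_singleton.1 h).symm
    · exact mem_singleton_self u
  calc (#A : ℝ) ≤ ∑ u ∈ B, (#(outerBoundary G {u}) : ℝ) := by
        exact_mod_cast (card_le_card hsub).trans
          (card_biUnion_le.trans (sum_le_sum fun u _ => card_image_le))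
    _ ≤ ∑ u ∈ B, d * (1 + ε) := sum_le_sum fun u _ => hG.degree_le u
    _ = _ := by rw [sum_const, nsmul_eq_mul]

end Growth

/-! ### Random placement of the cops -/

section Placement

variable {V : Type*} [Fintype V]

open Classical in
/-- Chernoff's lower tail for `N` independent uniform vertices, as a count of placements. -/
theorem card_few_in_le {N : ℕ} (B : Finset V) (hV : 0 < Fintype.card V) (t : ℝ) :
    (#{f : Fin N → V | (#{i | f i ∈ B} : ℝ) < t} : ℝ) ≤
      (Fintype.card V : ℝ) ^ N * Real.exp (t - N * #B / (2 * Fintype.card V)) := by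
  set n : ℝ := (Fintype.card V : ℝ) with hn
  have hn0 : 0 < n := by rw [hn]; exact_mod_cast hV
  set c : ℝ := Real.exp (-1) with hc
  have hc0 : 0 < c := Real.exp_pos _
  have hc2 : c ≤ 1 / 2 := by
    rw [hc, Real.exp_neg, one_div]
    gcongr
    linarith [Real.exp_one_gt_d9]
  have hBn : (#B : ℝ) ≤ n := by rw [hn]; exact_mod_cast card_le_univ B
  have hgen : ∑ f : Fin N → V, c ^ #{i | f i ∈ B} = (n - (1 - c) * #B) ^ N := by
    calc ∑ f : Fin N → V, c ^ #{i | f i ∈ B}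
        = ∑ f : Fin N → V, ∏ i, if f i ∈ B then c else 1 := by
          refine sum_congr rfl fun f _ => ?_
          rw [prod_ite, prod_const, prod_const_one, mul_one]
      _ = ∏ _i : Fin N, ∑ x : V, if x ∈ B then c else 1 := by
          rw [prod_univ_sum, Fintype.piFinset_univ]
      _ = (n - (1 - c) * #B) ^ N := by
          have hx : ∀ x : V, (if x ∈ B then c else 1) = 1 - (1 - c) * (if x ∈ B then 1 else 0) :=
            fun x => by split_ifs <;> ring
          rw [prod_const, card_univ, Fintype.card_fin]
          congr 1
          simp_rw [hx]
          rw [sum_sub_distrib, ← mul_sum]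
          simp [hn]
  calc (#{f : Fin N → V | (#{i | f i ∈ B} : ℝ) < t} : ℝ)
      ≤ ∑ f : Fin N → V, Real.exp t * c ^ #{i | f i ∈ B} := by
        rw [card_eq_sum_ones, Nat.cast_sum, sum_filter]
        refine sum_le_sum fun f _ => ?_
        split_ifs with hf
        · rw [hc, ← Real.exp_nat_mul, ← Real.exp_add, Nat.cast_one, Real.one_le_exp_iff]
          linarith
        · positivity
    _ = Real.exp t * (n - (1 - c) * #B) ^ N := by rw [← mul_sum, hgen]
    _ ≤ Real.exp t * (n * Real.exp (-(#B / (2 * n)))) ^ N := by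
        have h1 : 0 ≤ n - (1 - c) * #B := by nlinarith [(Nat.cast_nonneg #B : (0 : ℝ) ≤ #B)]
        have h2 : n - (1 - c) * #B ≤ n * Real.exp (-(#B / (2 * n))) := by
          calc n - (1 - c) * #B ≤ n * (-(#B / (2 * n)) + 1) := by
                have : n * (-(#B / (2 * n)) + 1) = n - #B / 2 := by
                  field_simp
                  ring
                rw [this]
                nlinarith [(Nat.cast_nonneg #B : (0 : ℝ) ≤ #B)]
            _ ≤ _ := by
                gcongr
                exact Real.add_one_le_exp _
        gcongr
    _ = n ^ N * Real.exp (t - N * #B / (2 * n)) := by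
        rw [mul_pow, ← Real.exp_nat_mul, mul_left_comm, ← Real.exp_add]
        ring_nf

open Classical in
/-- If the balls around the sets `U` of a family contain at least `β * #U` vertices, where
`12 n log n ≤ N β`, then `N` cops can be placed so that near each of these sets there are at least
a quarter of the cops expected there. -/
theorem exists_placement {N : ℕ} (hn : 4 ≤ Fintype.card V) (P : Finset V → Prop)
    (B : Finset V → Finset V) {β : ℝ} (hB : ∀ U, U.Nonempty → P U → β * #U ≤ #(B U))
    (hN : 12 * (Fintype.card V * Real.log (Fintype.card V)) ≤ N * β) :
    ∃ f : Fin N → V, ∀ U, U.Nonempty → P U →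
      N * (β * #U) / (4 * Fintype.card V) ≤ #{i | f i ∈ B U} := by
  set n : ℝ := (Fintype.card V : ℝ) with hn_def
  have hn4 : (4 : ℝ) ≤ n := by rw [hn_def]; exact_mod_cast hn
  set x : ℝ := (n ^ 3)⁻¹ with hx
  have hxexp : x = Real.exp (-(3 * Real.log n)) := (exp_neg_three_mul_log (by linarith)).symm
  have hnx : n * x = 1 / n ^ 2 := by
    rw [hx]
    field_simp
  have hn2 : 16 ≤ n ^ 2 := by nlinarith
  have hnx1 : n * x ≤ 1 / 16 := by
    rw [hnx]
    gcongr
  let bad : Finset V → Finset (Fin N → V) := fun U =>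
    {f | P U ∧ (#{i | f i ∈ B U} : ℝ) < N * (β * #U) / (4 * n)}
  have hbad : ∀ U, U.Nonempty → (#(bad U) : ℝ) ≤ n ^ N * x ^ #U := by
    intro U hU
    by_cases hP : P U
    · simp only [bad, hP, true_and]
      refine (card_few_in_le (B U) (by omega) _).trans ?_
      rw [← hn_def, hxexp, ← Real.exp_nat_mul]
      gcongr
      have h1 : N * (β * #U) / (2 * n) ≤ N * #(B U) / (2 * n) := by
        gcongr
        exact hB U hU hP
      have h2 : N * (β * #U) / (2 * n) = 2 * (N * (β * #U) / (4 * n)) := by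
        field_simp
        ring
      have h3 : #U * (3 * Real.log n) ≤ N * (β * #U) / (4 * n) := by
        rw [le_div_iff₀ (by positivity)]
        calc #U * (3 * Real.log n) * (4 * n) = 12 * (n * Real.log n) * #U := by ring
          _ ≤ N * β * #U := by gcongr
          _ = N * (β * #U) := by ring
      linarith
    · simp only [bad, hP, false_and, filter_false, card_empty, Nat.cast_zero]
      positivity
  have hlt : #(({U | U.Nonempty} : Finset (Finset V)).biUnion bad) <
      #(univ : Finset (Fin N → V)) := by
    have h : (#(({U | U.Nonempty} : Finset (Finset V)).biUnion bad) : ℝ) < n ^ N := by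
      calc (#(({U | U.Nonempty} : Finset (Finset V)).biUnion bad) : ℝ)
          ≤ ∑ U : Finset V with U.Nonempty, (#(bad U) : ℝ) := by
            exact_mod_cast card_biUnion_le
        _ ≤ ∑ U : Finset V with U.Nonempty, n ^ N * x ^ #U :=
            sum_le_sum fun U hU => hbad U (by simpa using hU)
        _ = n ^ N * ∑ U : Finset V with U.Nonempty, x ^ #U := (mul_sum _ _ _).symm
        _ ≤ n ^ N * (2 * (n * x)) := by
            gcongr
            exact sum_pow_card_nonempty_le (by positivity) (by rw [← hn_def]; linarith)
        _ < n ^ N := by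
            have : 0 < n ^ N := by positivity
            nlinarith
    rw [card_univ, Fintype.card_fun, Fintype.card_fin]
    rw [hn_def] at h
    exact_mod_cast h
  obtain ⟨f, -, hf⟩ := exists_mem_notMem_of_card_lt_card hlt
  refine ⟨f, fun U hU hP => ?_⟩
  by_contra! hcon
  exact hf (mem_biUnion.2 ⟨U, by simpa using hU, by simpa [bad] using ⟨hP, hcon⟩⟩)

end Placement

/-! ### Verification of Hall's condition -/

section Hall

variable {V : Type*} [Fintype V] {G : SimpleGraph V} {d p ε L : ℝ}

/-- On a typical graph `N ≥ 1024 d ^ (r + 1)` cops win. Let `A` be a set of edges near the robber,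
covering `k` vertices. If `k ≤ n / (4 d ^ r)`, then `A` has at most `7 k d ^ (2r + 1) / n` edges
because small sets are sparse, and `32 k d ^ (2r + 1) / n` cops are close. Otherwise a positive
fraction of all cops is close, and `A` has at most `4 d ^ (r + 1)` edges. -/
theorem IsTypical.containabilityNumber_le (hG : IsTypical G d p ε L) (hn : 4 ≤ Fintype.card V)
    (hL : L = Real.log (Fintype.card V)) (hL1 : 1 ≤ L) (hε0 : 0 ≤ ε) (hε : ε ≤ 1 / 4)
    (hd : 1 ≤ ε * d) {r N : ℕ} (hr : 1 ≤ r) (hrε : r * ε ≤ 1 / 4)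
    (hlow : Fintype.card V * L ≤ d ^ (2 * r + 1)) (hup : 4 * d ^ r ≤ Fintype.card V)
    (hp : p * Fintype.card V ≤ 2 * d) (hN : 1024 * d ^ (r + 1) ≤ N) :
    containabilityNumber G ≤ N := by
  classical
  set n : ℝ := (Fintype.card V : ℝ) with hn_def
  have hn4 : (4 : ℝ) ≤ n := by rw [hn_def]; exact_mod_cast hn
  have hd4 : 4 ≤ d := four_le_of_one_le_mul hε0 hε hd
  have hdr : 1 ≤ d ^ r := one_le_pow₀ (by linarith)
  have hnd : n ≤ d ^ (2 * r + 1) := by nlinarith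
  have hcops : 1024 * d ^ (2 * r + 1) ≤ N * d ^ r := by
    calc 1024 * d ^ (2 * r + 1) = 1024 * d ^ (r + 1) * d ^ r := by ring
      _ ≤ N * d ^ r := by gcongr
  obtain ⟨f, hf⟩ := exists_placement (N := N) hn (fun U => #U * d ^ r ≤ n / 4)
    (fun U => ball G U r) (β := d ^ r / 8)
    (fun U hU hUd => by
      have := hG.le_card_ball hε0 hε hd hr hrε hU hUd
      linarith)
    (by
      rw [← hL, ← hn_def]
      linarith [hlow])
  rw [← hn_def] at hf
  refine containabilityNumber_le_of_hall (r := r) f ?_ ?_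
  · intro x
    have hdr' : d ≤ d ^ r := le_self_pow₀ (by linarith) (by omega)
    have hdn : d / n ≤ 1 / 4 := by
      rw [div_le_iff₀ (by linarith)]
      linarith
    have h := hG.le_boundary {x} (singleton_nonempty x) (by
      rw [card_singleton, Nat.cast_one, one_mul, ← hn_def]
      linarith)
    rw [card_singleton, Nat.cast_one, one_mul, ← hn_def] at h
    have hpos : (0 : ℝ) < #(outerBoundary G {x}) :=
      lt_of_lt_of_le (mul_pos (by linarith) (by linarith)) h
    obtain ⟨y, hy⟩ := card_pos.1 (by exact_mod_cast hpos)
    obtain ⟨-, u, hu, huy⟩ := mem_outerBoundary.1 hy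
    exact ⟨y, mem_singleton.1 hu ▸ huy⟩
  · intro v A hA
    rcases A.eq_empty_or_nonempty with rfl | ⟨e₀, he₀⟩
    · simp
    set U := covered A with hU_def
    have hU : U.Nonempty := by
      obtain ⟨-, u, -, hu⟩ := hA e₀ he₀
      exact ⟨u, mem_covered.2 ⟨e₀, he₀, hu⟩⟩
    have hgoal : (#A : ℝ) ≤ #{i | f i ∈ ball G U r} := by
      by_cases hsmall : #U * d ^ r ≤ n / 4
      · refine le_trans ?_ (hf U hU hsmall)
        have hAin : A ⊆ insideEdges G U := fun e he =>
          mem_insideEdges.2 ⟨(hA e he).1, fun u hu => mem_covered.2 ⟨e, he, hu⟩⟩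
        have hA1 : (#A : ℝ) ≤ #U * (3 * L + 2 * p * #U) :=
          le_trans (by exact_mod_cast card_le_card hAin) (hG.inside_le U hU)
        have hU0 : (0 : ℝ) ≤ #U := by positivity
        have hUd : #U * d ≤ d ^ (2 * r + 1) := by
          have h1 : #U * d ≤ #U * d ^ r := by
            gcongr
            exact le_self_pow₀ (by linarith) (by omega)
          linarith
        rw [le_div_iff₀ (by linarith)]
        calc (#A : ℝ) * (4 * n) ≤ #U * (3 * L + 2 * p * #U) * (4 * n) := by gcongr
          _ = #U * (12 * (n * L) + 8 * (#U * (p * n))) := by ring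
          _ ≤ #U * (12 * (n * L) + 8 * (#U * (2 * d))) := by gcongr
          _ ≤ #U * (28 * d ^ (2 * r + 1)) := by
            gcongr
            linarith
          _ ≤ #U * (N * d ^ r / 8) := by
            gcongr
            have : 0 ≤ d ^ (2 * r + 1) := by positivity
            linarith
          _ = N * (d ^ r / 8 * #U) := by ring
      -- Only the largest number `k` of covered vertices that the placement still controls is used.
      · have hq1 : 1 ≤ n / (4 * d ^ r) := by
          rw [le_div_iff₀ (by linarith)]
          linarith
        set k : ℕ := ⌊n / (4 * d ^ r)⌋₊ with hk
        have hk1 : 1 ≤ k := Nat.one_le_floor_iff _ |>.2 hq1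
        have hkle : k * d ^ r ≤ n / 4 := by
          have h := Nat.floor_le (zero_le_one.trans hq1)
          rw [← hk, le_div_iff₀ (by linarith)] at h
          linarith
        have hkge : n / 8 ≤ k * d ^ r := by
          have h := Nat.lt_floor_add_one (n / (4 * d ^ r))
          rw [← hk, div_lt_iff₀ (by linarith)] at h
          have hk1' : (1 : ℝ) ≤ k := by exact_mod_cast hk1
          nlinarith
        have hkU : k ≤ #U := by
          have h : (k : ℝ) ≤ #U := by
            by_contra! hlt
            exact hsmall (le_trans (by gcongr) hkle)
          exact_mod_cast h
        obtain ⟨W, hWU, hW⟩ := exists_subset_card_eq hkU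
        have hWne : W.Nonempty := by
          rw [← card_pos, hW]
          omega
        have hcount := hf W hWne (by rw [hW]; exact hkle)
        have hA1 : (#A : ℝ) ≤ 4 * d ^ (r + 1) := by
          calc (#A : ℝ) ≤ #(ball G {v} r) * (d * (1 + ε)) := hG.card_edges_le hA
            _ ≤ 2 * d ^ r * (d * 2) := by
              gcongr
              · exact hG.card_ball_le hε0 hd hrε v
              · linarith
            _ = 4 * d ^ (r + 1) := by ring
        have hmono : #{i | f i ∈ ball G W r} ≤ #{i | f i ∈ ball G U r} :=
          card_le_card fun i hi => by
            simp only [mem_filter, mem_univ, true_and] at hi ⊢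
            exact ball_mono hWU r hi
        calc (#A : ℝ) ≤ N / 256 := by linarith
          _ ≤ N * (d ^ r / 8 * #W) / (4 * n) := by
            rw [le_div_iff₀ (by linarith), hW]
            calc (N : ℝ) / 256 * (4 * n) = N / 8 * (n / 8) := by ring
              _ ≤ N / 8 * (k * d ^ r) := by gcongr
              _ = N * (d ^ r / 8 * k) := by ring
          _ ≤ #{i | f i ∈ ball G W r} := hcount
          _ ≤ #{i | f i ∈ ball G U r} := by exact_mod_cast hmono
    exact_mod_cast hgoal

end Hall

/-! ### Asymptotics -/

/-- The inequalities between `n`, `L = log n`, `d` and `r` that the argument uses, with `ε = 4 / L`: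
the bound `d ^ (2r) ≤ n L` and `d ≥ L ^ 3` force `r ≤ L / 16`. -/
theorem parameter_bounds {n d L : ℝ} {r : ℕ} (hLn : L = Real.log n) (hn : 16 * L ≤ n)
    (hL : Real.exp 6 ≤ L) (hd : L ^ 3 ≤ d) (hr : 1 ≤ r)
    (hlow : (n * L) ^ (1 / (2 * (r : ℝ) + 1)) ≤ d) (hup : d ≤ (n * L) ^ (1 / (2 * (r : ℝ)))) :
    16 ≤ L ∧ r * (4 / L) ≤ 1 / 4 ∧ n * L ≤ d ^ (2 * r + 1) ∧ 4 * d ^ r ≤ n := by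
  have hL16 : 16 ≤ L := by
    refine le_trans ?_ hL
    rw [show (6 : ℝ) = ((6 : ℕ) : ℝ) * 1 by norm_num, Real.exp_nat_mul]
    calc (16 : ℝ) ≤ 2 ^ 6 := by norm_num
      _ ≤ Real.exp 1 ^ 6 := by
        gcongr
        linarith [Real.exp_one_gt_d9]
  have hL0 : 0 < L := by linarith
  have hn0 : 0 < n := by linarith
  have hnL : 0 ≤ n * L := by positivity
  have hd0 : 0 < d := lt_of_lt_of_le (by positivity) hd
  have hr1 : (1 : ℝ) ≤ r := by exact_mod_cast hr
  have hpow : d ^ (2 * r) ≤ n * L := by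
    have h := pow_le_pow_left₀ hd0.le hup (2 * r)
    rw [← Real.rpow_mul_natCast hnL] at h
    push_cast at h
    rwa [one_div_mul_cancel (by positivity), Real.rpow_one] at h
  have hpow' : n * L ≤ d ^ (2 * r + 1) := by
    have h := pow_le_pow_left₀ (Real.rpow_nonneg hnL _) hlow (2 * r + 1)
    rw [← Real.rpow_mul_natCast hnL] at h
    push_cast at h
    rwa [one_div_mul_cancel (by positivity), Real.rpow_one] at h
  refine ⟨hL16, ?_, hpow', ?_⟩
  · have hlogL : 6 ≤ Real.log L := (Real.le_log_iff_exp_le hL0).2 hL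
    have hlogd : 16 ≤ Real.log d := by
      have h := Real.log_le_log (by positivity) hd
      rw [Real.log_pow] at h
      push_cast at h
      linarith
    have hlog := Real.log_le_log (by positivity) hpow
    rw [Real.log_pow, Real.log_mul hn0.ne' hL0.ne', ← hLn] at hlog
    push_cast at hlog
    have hLL : Real.log L ≤ L := (Real.log_le_sub_one_of_pos hL0).trans (by linarith)
    have h16 : 2 * (r : ℝ) * 16 ≤ 2 * r * Real.log d := by gcongr
    rw [mul_div_assoc', div_le_iff₀ hL0]
    linarith
  · have hsq : (4 * d ^ r) ^ 2 ≤ n ^ 2 := by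
      calc (4 * d ^ r) ^ 2 = 16 * d ^ (2 * r) := by ring
        _ ≤ n * (16 * L) := by linarith
        _ ≤ n ^ 2 := by
          rw [sq]
          gcongr
    exact le_of_sq_le_sq hsq hn0.le

end Containment

theorem lemma2p5 (p : ℕ → unitInterval) (d : ℕ → ℝ) (r : ℕ → ℕ)
    (hd : ∀ n : ℕ, d n = (p n : ℝ) * ((n : ℝ) - 1))
    (hlog : ∀ᶠ n : ℕ in Filter.atTop, Real.log (n : ℝ) ^ 3 ≤ d n)
    (hr : ∀ᶠ n : ℕ in Filter.atTop, 1 ≤ r n ∧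
      ((n : ℝ) * Real.log (n : ℝ)) ^ (1 / (2 * (r n : ℝ) + 1)) ≤ d n ∧
      d n ≤ ((n : ℝ) * Real.log (n : ℝ)) ^ (1 / (2 * (r n : ℝ)))) :
    ∃ K : ℝ, 0 < K ∧
      Filter.Tendsto
        (fun n : ℕ => SimpleGraph.binomialRandom (Fin n) (p n)
          {G : SimpleGraph (Fin n) |
            (Containment.containabilityNumber G : ℝ) ≤ K * d n ^ (r n + 1)})
        Filter.atTop (nhds 1) := by
  -- `1024 d ^ (r + 1)` cops suffice; the surplus absorbs rounding down, as `1 ≤ d ^ (r + 1)`.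
  refine ⟨1025, by norm_num, ?_⟩
  have hlogn : ∀ᶠ n : ℕ in Filter.atTop, 16 * Real.log (n : ℝ) ≤ n := by
    have h := (Real.isLittleO_log_id_atTop.bound (show (0 : ℝ) < 1 / 16 by norm_num)).filter_mono
      tendsto_natCast_atTop_atTop
    filter_upwards [Filter.eventually_map.1 h] with n hn
    simp only [id, Real.norm_eq_abs, Nat.abs_cast] at hn
    linarith [le_abs_self (Real.log (n : ℝ))]
  have hlogL : ∀ᶠ n : ℕ in Filter.atTop, Real.exp 6 ≤ Real.log (n : ℝ) :=
    (Real.tendsto_log_atTop.comp tendsto_natCast_atTop_atTop).eventually_ge_atTop _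
  have hlim : Filter.Tendsto (fun n : ℕ => ENNReal.ofReal (1 - 5 / (n : ℝ) ^ 2)) Filter.atTop
      (nhds 1) := by
    rw [← ENNReal.ofReal_one]
    refine ENNReal.tendsto_ofReal ?_
    have h : Filter.Tendsto (fun n : ℕ => 5 / (n : ℝ) ^ 2) Filter.atTop (nhds 0) :=
      Filter.Tendsto.const_div_atTop
        ((Filter.tendsto_pow_atTop two_ne_zero).comp tendsto_natCast_atTop_atTop) 5
    simpa using h.const_sub 1
  refine tendsto_of_tendsto_of_tendsto_of_le_of_le' hlim tendsto_const_nhds ?_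
    (.of_forall fun n => MeasureTheory.prob_le_one)
  filter_upwards [hlog, hr, hlogn, hlogL, Filter.eventually_ge_atTop 4]
    with n hdn ⟨hr1, hlow, hup⟩ hnL hL hn4
  set L : ℝ := Real.log (n : ℝ) with hL_def
  obtain ⟨hL16, hrε, hlow', hup'⟩ := Containment.parameter_bounds hL_def hnL hL hdn hr1 hlow hup
  have hL0 : 0 < L := by linarith
  have hn4' : (4 : ℝ) ≤ n := by exact_mod_cast hn4
  have hcard : Fintype.card (Fin n) = n := Fintype.card_fin n
  have hε : 4 / L ≤ 1 / 4 := by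
    rw [div_le_iff₀ hL0]
    linarith
  have hεd : 1 ≤ 4 / L * d n := by
    calc (1 : ℝ) ≤ 4 * L ^ 2 := by nlinarith
      _ = 4 / L * L ^ 3 := by field_simp
      _ ≤ 4 / L * d n := by gcongr
  have hεd' : 12 * L ≤ (4 / L) ^ 2 * d n := by
    calc 12 * L ≤ 16 * L := by linarith
      _ = (4 / L) ^ 2 * L ^ 3 := by
        field_simp
        norm_num
      _ ≤ (4 / L) ^ 2 * d n := by gcongr
  have hd4 : 4 ≤ d n := Containment.four_le_of_one_le_mul (by positivity) hε hεd
  have hbad := Containment.measureReal_not_isTypical_le (V := Fin n) (ε := 4 / L) (L := L) (p n)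
    (by rw [hcard]; exact hd n) hd4 (by rwa [hcard]) (by positivity) (by linarith)
    (by rw [hcard]) hεd'
  rw [hcard] at hbad
  have hgood : {G : SimpleGraph (Fin n) | ¬ Containment.IsTypical G (d n) (p n) (4 / L) L}ᶜ ⊆
      {G | (Containment.containabilityNumber G : ℝ) ≤ 1025 * d n ^ (r n + 1)} := by
    intro G hG
    have hG' : Containment.IsTypical G (d n) (p n) (4 / L) L := not_not.1 hG
    have hpow : 1 ≤ d n ^ (r n + 1) := one_le_pow₀ (by linarith)
    have hwin := hG'.containabilityNumber_le (N := ⌊1025 * d n ^ (r n + 1)⌋₊)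
      (by rwa [hcard]) (by rw [hcard]) (by linarith) (by positivity) hε hεd hr1 hrε
      (by rw [hcard]; exact hlow') (by rw [hcard]; exact hup')
      (by
        rw [hcard, hd n]
        nlinarith [(p n).2.1])
      (by linarith [Nat.lt_floor_add_one (1025 * d n ^ (r n + 1))])
    exact (Nat.cast_le.2 hwin).trans (Nat.floor_le (by positivity))
  calc ENNReal.ofReal (1 - 5 / (n : ℝ) ^ 2)
      ≤ ENNReal.ofReal ((SimpleGraph.binomialRandom (Fin n) (p n)).real
          {G | ¬ Containment.IsTypical G (d n) (p n) (4 / L) L}ᶜ) := by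
        rw [MeasureTheory.probReal_compl_eq_one_sub (Set.toFinite _).measurableSet]
        gcongr
    _ = SimpleGraph.binomialRandom (Fin n) (p n)
          {G | ¬ Containment.IsTypical G (d n) (p n) (4 / L) L}ᶜ := MeasureTheory.ofReal_measureReal
    _ ≤ _ := MeasureTheory.measure_mono hgood
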